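/- Let $\mathbf{k}$ be a field and let $c \ge 1$ be an integer. For $n \ge 1$ let $R_n = \mathbf{k}[x_{i,j} \mid 1\le i\le c,\ 1\le j\le n]$, with the action of $\operatorname{Sym}(n)$ by $\mathbf{k}$-algebra automorphisms given by $\sigma\cdot x_{i,j} = x_{i,\sigma(j)}$; for $m \le n$ regard $R_m$ as a subring of $R_n$. Let $(I_n)_{n\ge 1}$ be a $\operatorname{Sym}$-invariant chain of squarefree monomial ideals, that is, each $I_n \subseteq R_n$ is an ideal generated by squarefree monomials, and $\sigma(f)\in I_n$ whenever $1\le m\le n$, $f\in I_m$ and $\sigma\in\operatorname{Sym}(n)$. Then the number of $\operatorname{Sym}(n)$-orbits of primary components of $I_n$ is eventually a polynomial in $n$, and it equals the number of $\operatorname{Sym}(n)$-orbits of associated primes of $I_n$ for large $n$: there are a polynomial $p\in\mathbb{Q}[t]$ and an integer $n_0$ such that, for every $n\ge n_0$, the set of primary components of $I_n$ (the ideals occurring in a minimal primary decomposition of $I_n$) and the set of associated primes of $R_n/I_n$ each consist of exactly $p(n)$ orbits under $\operatorname{Sym}(n)$. -/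

import Mathlib

open MvPolynomial

/-- The polynomial ring `R_n = k[x_{i,j} | i ∈ [c], j ∈ [n]]`. -/
abbrev SymRing (k : Type*) [Field k] (c n : ℕ) : Type _ :=
  MvPolynomial (Fin c × Fin n) k

/-- The action of `σ ∈ Sym(n)` on `R_n` by `σ · x_{i,j} = x_{i,σ(j)}`. -/
noncomputable def symAct (k : Type*) [Field k] (c : ℕ) {n : ℕ} (σ : Equiv.Perm (Fin n)) :
    SymRing k c n ≃ₐ[k] SymRing k c n :=
  MvPolynomial.renameEquiv k (Equiv.prodCongr (Equiv.refl (Fin c)) σ)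

/-- The inclusion `R_m ⊆ R_n`, `x_{i,j} ↦ x_{i,j}`, for `m ≤ n`. -/
noncomputable def symIncl (k : Type*) [Field k] (c : ℕ) {m n : ℕ} (h : m ≤ n) :
    SymRing k c m →ₐ[k] SymRing k c n :=
  MvPolynomial.rename (Prod.map id (Fin.castLE h))

/-- An ideal of a polynomial ring generated by squarefree monomials, that is, by products of
distinct variables. -/
def IsSquarefreeMonomialIdeal {τ k : Type*} [Field k] (I : Ideal (MvPolynomial τ k)) : Prop :=
  ∃ S : Set (Finset τ), I = Ideal.span ((fun s : Finset τ => ∏ v ∈ s, (X v : MvPolynomial τ k)) '' S)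

/-- `(I_n)_{n ≥ 1}` is a `Sym`-invariant chain: `σ(f) ∈ I_n` for all `f ∈ I_m`, `σ ∈ Sym(n)` and
`1 ≤ m ≤ n`, where `R_m` is regarded as a subring of `R_n`. The value at `0` plays no role. -/
def IsSymInvariantChain {k : Type*} [Field k] {c : ℕ} (I : (n : ℕ) → Ideal (SymRing k c n)) :
    Prop :=
  ∀ (m n : ℕ) (h : m ≤ n), 1 ≤ m → ∀ f ∈ I m, ∀ σ : Equiv.Perm (Fin n),
    symAct k c σ (symIncl k c h f) ∈ I n

/-- The primary components of an ideal: the ideals that occur in a minimal (irredundant, with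
distinct radicals) primary decomposition. -/
def primaryComponents {R : Type*} [CommRing R] (I : Ideal R) : Set (Ideal R) :=
  {Q | ∃ t : Finset (Ideal R), Submodule.IsMinimalPrimaryDecomposition I t ∧ Q ∈ t}

/-- The `Sym(n)`-orbit of an ideal of `R_n`. -/
def symOrbit {k : Type*} [Field k] {c n : ℕ} (Q : Ideal (SymRing k c n)) :
    Set (Ideal (SymRing k c n)) :=
  Set.range fun σ : Equiv.Perm (Fin n) => Ideal.map (symAct k c σ) Q

/-- The set of `Sym(n)`-orbits of the members of a set of ideals of `R_n`. -/
def symOrbits {k : Type*} [Field k] {c n : ℕ} (S : Set (Ideal (SymRing k c n))) :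
    Set (Set (Ideal (SymRing k c n))) :=
  symOrbit '' S

/-! Squarefree monomial ideals are radical, so primary components and associated primes both
coincide with the minimal primes. These are the ideals `varIdeal k F`, for `F` maximal among sets of
variables whose product is not in `I n` (the facets of the Stanley–Reisner complex). A
`Sym(n)`-orbit of sets `F` is determined by how many columns of `F` equal each `A ⊆ [c]`: a vector
`v` of natural numbers with total `n`. By invariance, the monomial of `F` lies in `I n` iff `v` lies
in an upper set `chainCounts I` that does not depend on `n`. Maximality becomes: `v` is outside this
set, but replacing one column `A` by `A ∪ {i}` always leads into it
(`IsSymInvariantChain.maximal_iff`). This is a Boolean combination of upper sets. By Dickson's lemma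
its indicator is a linear combination of orthant indicators, and an orthant has a binomial number of
points of total `n`, polynomial for large `n`. -/

/-! ### Radical ideals: components and associated primes -/

/-- An associated prime of the quotient by a radical ideal is a minimal prime. -/
theorem Ideal.IsRadical.minimalPrimes_of_mem_associatedPrimes {R : Type*} [CommRing R]
    {I P : Ideal R} (hI : I.IsRadical) (hP : P ∈ associatedPrimes R (R ⧸ I)) :
    P ∈ I.minimalPrimes := by
  obtain ⟨hprime, x, hx⟩ := hP
  obtain ⟨x, rfl⟩ := Ideal.Quotient.mk_surjective x
  -- The powers arise because `hx` presents `P` as the radical of a colon ideal.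
  have key : ∀ r, r ∈ P ↔ ∃ n, r ^ n * x ∈ I := by
    intro r
    rw [hx, Ideal.mem_radical_iff]
    refine exists_congr fun n => ?_
    rw [Submodule.mem_colon_singleton, Submodule.mem_bot, Algebra.smul_def,
      Ideal.Quotient.algebraMap_eq, ← map_mul, Ideal.Quotient.eq_zero_iff_mem]
  have hxP : x ∉ P := by
    intro h
    obtain ⟨n, hn⟩ := (key x).1 h
    rw [← pow_succ] at hn
    exact hprime.ne_top ((Ideal.eq_top_iff_one P).2 ((key 1).2 ⟨0, by simpa using hI ⟨_, hn⟩⟩))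
  refine ⟨⟨hprime, fun r hr => (key r).2 ⟨1, I.mul_mem_right _ (by simpa using hr)⟩⟩, ?_⟩
  rintro P' ⟨hP', hIP'⟩ hle r hr
  obtain ⟨n, hn⟩ := (key r).1 hr
  exact hP'.mem_of_pow_mem n
    ((hP'.mem_or_mem (hIP' hn)).resolve_right fun h => hxP (hle h))

theorem Ideal.IsRadical.associatedPrimes_eq_minimalPrimes {R : Type*} [CommRing R]
    [IsNoetherianRing R] {I : Ideal R} (hI : I.IsRadical) :
    associatedPrimes R (R ⧸ I) = I.minimalPrimes := by
  refine Set.Subset.antisymm (fun P hP => hI.minimalPrimes_of_mem_associatedPrimes hP) ?_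
  have := Module.associatedPrimes.minimalPrimes_annihilator_subset_associatedPrimes R (R ⧸ I)
  rwa [Ideal.annihilator_quotient] at this

/-- The members of a minimal primary decomposition of a radical ideal are minimal primes. -/
theorem Ideal.IsRadical.mem_minimalPrimes_of_isMinimalPrimaryDecomposition {R : Type*}
    [CommRing R] {I Q : Ideal R} (hI : I.IsRadical) {t : Finset (Ideal R)}
    (ht : Submodule.IsMinimalPrimaryDecomposition I t) (hQ : Q ∈ t) : Q ∈ I.minimalPrimes := by
  classical
  obtain ⟨x, hxt, hxQ⟩ := SetLike.not_le_iff_exists.mp (ht.minimal hQ)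
  have hprim : Q.IsPrimary := ht.primary hQ
  have hIQ : I ≤ Q := by
    rw [← ht.inf_eq]; exact Finset.inf_le (f := id) hQ
  have hmem : ∀ y, y ∈ Q → y ∈ (t.erase Q).inf id → y ∈ I := by
    intro y h1 h2
    rw [← ht.inf_eq, ← Finset.insert_erase hQ, Finset.inf_insert]
    exact ⟨h1, h2⟩
  -- With `r ^ n ∈ Q`, the power `(r * x) ^ (n + 1)` lies in `Q` through `r ^ n` and in the other
  -- components through `x`, hence in the radical ideal `I`.
  have hmul : ∀ r ∈ Q.radical, r * x ∈ I := by
    rintro r ⟨n, hn⟩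
    refine hI ⟨n + 1, hmem _ ?_ ?_⟩
    · rw [mul_pow, pow_succ, mul_assoc]
      exact Q.mul_mem_right _ hn
    · rw [pow_succ, ← mul_assoc]
      exact Ideal.mul_mem_left _ _ hxt
  have hxr : x ∉ Q.radical := fun h => hxQ (hIQ (hI ⟨2, by rw [sq]; exact hmul x h⟩))
  have hrad : Q.radical = Q := by
    refine le_antisymm (fun r hr => ?_) Ideal.le_radical
    exact ((Ideal.isPrimary_iff.1 hprim).2 (hIQ (hmul r hr))).resolve_right hxr
  have hpr : Q.IsPrime := hrad ▸ Ideal.isPrime_radical hprim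
  refine ⟨⟨hpr, hIQ⟩, ?_⟩
  rintro P' ⟨hP', hIP'⟩ hle r hr
  exact (hP'.mem_or_mem (hIP' (hmul r (hrad.symm ▸ hr)))).resolve_right fun h => hxQ (hle h)

theorem Ideal.IsRadical.primaryComponents_eq_minimalPrimes {R : Type*} [CommRing R]
    [IsNoetherianRing R] {I : Ideal R} (hI : I.IsRadical) :
    primaryComponents I = I.minimalPrimes := by
  ext Q
  constructor
  · rintro ⟨t, ht, hQ⟩
    exact hI.mem_minimalPrimes_of_isMinimalPrimaryDecomposition ht hQ
  · intro hQ
    obtain ⟨t, ht⟩ :=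
      Submodule.IsLasker.exists_isMinimalPrimaryDecomposition (Submodule.isLasker R R) I
    obtain ⟨q, hq, rfl⟩ :=
      Ideal.IsMinimalPrimaryDecomposition.minimalPrimes_subset_image_radical ht hQ
    have := (hI.mem_minimalPrimes_of_isMinimalPrimaryDecomposition ht hq).1.1.radical
    exact ⟨t, ht, this.symm ▸ hq⟩

/-! ### Squarefree monomial ideals and their minimal primes -/

/-- The ideal generated by the variables outside a finite set. -/
noncomputable def varIdeal (k : Type*) [Field k] {τ : Type*} (F : Finset τ) :
    Ideal (MvPolynomial τ k) :=
  Ideal.span (X '' {v | v ∉ F})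

/-- The squarefree monomial attached to a finite set of variables. -/
noncomputable def sqfreeMonomial (k : Type*) [Field k] {τ : Type*} (F : Finset τ) :
    MvPolynomial τ k :=
  ∏ v ∈ F, X v

section SquarefreeIdeals

variable {k : Type*} [Field k] {τ : Type*}

theorem sqfreeMonomial_eq_monomial (F : Finset τ) :
    sqfreeMonomial k F = monomial (∑ v ∈ F, Finsupp.single v 1) 1 := by
  rw [sqfreeMonomial, monomial_sum_one]
  rfl

theorem sum_single_one_le_iff (F : Finset τ) (m : τ →₀ ℕ) :
    ∑ v ∈ F, Finsupp.single v 1 ≤ m ↔ F ⊆ m.support := by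
  classical
  rw [Finsupp.le_def]
  simp only [Finsupp.finsetSum_apply, Finsupp.single_apply, Finset.sum_ite_eq',
    Finset.subset_iff, Finsupp.mem_support_iff]
  refine forall_congr' fun v => ?_
  split_ifs with h <;> simp [h, Nat.one_le_iff_ne_zero]

theorem support_sum_single_one (F : Finset τ) :
    (∑ v ∈ F, Finsupp.single v 1 : τ →₀ ℕ).support = F := by
  classical
  ext v
  simp [Finsupp.finsetSum_apply, Finsupp.single_apply]

theorem mem_span_sqfreeMonomial_iff (S : Set (Finset τ)) (f : MvPolynomial τ k) :
    f ∈ Ideal.span (sqfreeMonomial k '' S) ↔ ∀ m ∈ f.support, ∃ s ∈ S, s ⊆ m.support := by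
  have : sqfreeMonomial k '' S = (fun m => monomial m (1 : k)) ''
      ((fun F : Finset τ => ∑ v ∈ F, Finsupp.single v 1) '' S) := by
    rw [Set.image_image]
    exact Set.image_congr fun F _ => sqfreeMonomial_eq_monomial F
  rw [this, mem_ideal_span_monomial_image]
  simp only [Set.exists_mem_image, sum_single_one_le_iff]

theorem sqfreeMonomial_mem_span_iff (S : Set (Finset τ)) (F : Finset τ) :
    sqfreeMonomial k F ∈ Ideal.span (sqfreeMonomial k '' S) ↔ ∃ s ∈ S, s ⊆ F := by
  rw [mem_span_sqfreeMonomial_iff, sqfreeMonomial_eq_monomial]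
  classical
  rw [support_monomial, if_neg one_ne_zero]
  simp only [Finset.mem_singleton, forall_eq, support_sum_single_one]

theorem sqfreeMonomial_dvd {F G : Finset τ} (h : F ⊆ G) :
    sqfreeMonomial k F ∣ sqfreeMonomial k G :=
  Finset.prod_dvd_prod_of_subset _ _ _ h

theorem mem_varIdeal_iff (F : Finset τ) (f : MvPolynomial τ k) :
    f ∈ varIdeal k F ↔ ∀ m ∈ f.support, ¬ m.support ⊆ F := by
  rw [varIdeal, mem_ideal_span_X_image]
  simp only [Finset.not_subset, Finsupp.mem_support_iff, Set.mem_ofPred_eq]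
  refine forall₂_congr fun m _ => exists_congr fun v => and_comm

theorem X_mem_varIdeal_iff (F : Finset τ) (v : τ) : X v ∈ varIdeal k F ↔ v ∉ F := by
  rw [mem_varIdeal_iff, support_X]
  simp

theorem varIdeal_le_varIdeal_iff (F G : Finset τ) : varIdeal k F ≤ varIdeal k G ↔ G ⊆ F := by
  constructor
  · intro h v hv
    by_contra hF
    exact (X_mem_varIdeal_iff G v).1 (h ((X_mem_varIdeal_iff F v).2 hF)) hv
  · intro h
    exact Ideal.span_mono (Set.image_mono fun v hv hG => hv (h hG))

theorem varIdeal_injective : Function.Injective (varIdeal k : Finset τ → _) := fun F G h =>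
  Finset.Subset.antisymm ((varIdeal_le_varIdeal_iff G F).1 h.ge)
    ((varIdeal_le_varIdeal_iff F G).1 h.le)

/-- It is the kernel of the substitution that kills the variables outside `F`, a map into a domain.
-/
theorem varIdeal_isPrime (F : Finset τ) : (varIdeal k F).IsPrime := by
  classical
  let φ : MvPolynomial τ k →ₐ[k] MvPolynomial τ k := aeval fun v => if v ∈ F then X v else 0
  have hφ : ∀ f, f - φ f ∈ varIdeal k F := by
    intro f
    rw [← Ideal.Quotient.eq]
    have : (Ideal.Quotient.mkₐ k (varIdeal k F)) =
        (Ideal.Quotient.mkₐ k (varIdeal k F)).comp φ := by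
      refine MvPolynomial.algHom_ext fun v => ?_
      simp only [AlgHom.comp_apply, φ, aeval_X]
      split_ifs with h
      · rfl
      · rw [map_zero]
        exact Ideal.Quotient.eq_zero_iff_mem.2 ((X_mem_varIdeal_iff F v).2 h)
    exact DFunLike.congr_fun this f
  have hker : RingHom.ker φ = varIdeal k F := by
    refine le_antisymm (fun f hf => ?_) (Ideal.span_le.2 ?_)
    · have := hφ f
      rwa [(RingHom.mem_ker).1 hf, sub_zero] at this
    · rintro _ ⟨v, hv, rfl⟩
      rw [SetLike.mem_coe, RingHom.mem_ker]
      simp only [φ, aeval_X]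
      exact if_neg hv
  rw [← hker]
  exact RingHom.ker_isPrime _

namespace IsSquarefreeMonomialIdeal

variable {I : Ideal (MvPolynomial τ k)}

theorem le_varIdeal_iff (hI : IsSquarefreeMonomialIdeal I) (F : Finset τ) :
    I ≤ varIdeal k F ↔ sqfreeMonomial k F ∉ I := by
  obtain ⟨S, rfl⟩ := hI
  change Ideal.span (sqfreeMonomial k '' S) ≤ _ ↔ _ ∉ Ideal.span (sqfreeMonomial k '' S)
  rw [sqfreeMonomial_mem_span_iff, Ideal.span_le]
  constructor
  · rintro h ⟨s, hs, hsF⟩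
    have := h (Set.mem_image_of_mem _ hs)
    rw [SetLike.mem_coe, mem_varIdeal_iff, sqfreeMonomial_eq_monomial] at this
    refine this (∑ v ∈ s, Finsupp.single v 1) ?_ (by rwa [support_sum_single_one])
    classical
    rw [mem_support_iff, coeff_monomial, if_pos rfl]
    exact one_ne_zero
  · rintro h _ ⟨s, hs, rfl⟩
    have : ¬ s ⊆ F := fun hsF => h ⟨s, hs, hsF⟩
    obtain ⟨v, hv, hvF⟩ := Finset.not_subset.1 this
    exact Ideal.mem_of_dvd _ (Finset.dvd_prod_of_mem _ hv) ((X_mem_varIdeal_iff F v).2 hvF)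

/-- A radical element lies in every `varIdeal k F` containing `I`. If the support of one of its
monomials had product outside `I`, that support taken as `F` would give a contradiction. -/
theorem isRadical (hI : IsSquarefreeMonomialIdeal I) : I.IsRadical := by
  rintro f ⟨n, hn⟩
  have hprime : ∀ F, sqfreeMonomial k F ∉ I → f ∈ varIdeal k F := fun F hF =>
    (varIdeal_isPrime F).mem_of_pow_mem n ((hI.le_varIdeal_iff F).2 hF hn)
  obtain ⟨S, rfl⟩ := hI
  change f ∈ Ideal.span (sqfreeMonomial k '' S)
  rw [mem_span_sqfreeMonomial_iff]
  intro m hm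
  rw [← sqfreeMonomial_mem_span_iff (k := k)]
  by_contra h
  exact (mem_varIdeal_iff _ _).1 (hprime _ h) m hm Finset.Subset.rfl

theorem minimalPrimes_eq [Finite τ] (hI : IsSquarefreeMonomialIdeal I) :
    I.minimalPrimes = varIdeal k '' {F | Maximal (fun F => sqfreeMonomial k F ∉ I) F} := by
  classical
  have := Fintype.ofFinite τ
  have key : ∀ P : Ideal (MvPolynomial τ k), P.IsPrime → I ≤ P →
      ∃ F, sqfreeMonomial k F ∉ I ∧ varIdeal k F ≤ P := by
    intro P hP hIP
    -- A product of variables outside the prime `P` is outside `P`, hence outside `I`.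
    refine ⟨Finset.univ.filter fun v => X v ∉ P, fun h => ?_, Ideal.span_le.2 ?_⟩
    · have h1 := hIP h
      rw [sqfreeMonomial, hP.prod_mem_iff] at h1
      obtain ⟨v, hv, hvP⟩ := h1
      exact (Finset.mem_filter.1 hv).2 hvP
    · rintro _ ⟨v, hv, rfl⟩
      simpa using hv
  ext P
  constructor
  · rintro ⟨⟨hP, hIP⟩, hmin⟩
    obtain ⟨F, hF, hFP⟩ := key P hP hIP
    have hPF := hmin ⟨varIdeal_isPrime F, (hI.le_varIdeal_iff F).2 hF⟩ hFP
    refine ⟨F, ⟨hF, fun G hG hFG => ?_⟩, le_antisymm hFP hPF⟩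
    have hGF := (varIdeal_le_varIdeal_iff (k := k) G F).2 hFG
    have hPG := hmin ⟨varIdeal_isPrime G, (hI.le_varIdeal_iff G).2 hG⟩ (hGF.trans hFP)
    exact (varIdeal_le_varIdeal_iff F G).1 (hFP.trans hPG)
  · rintro ⟨F, ⟨hF, hmax⟩, rfl⟩
    refine ⟨⟨varIdeal_isPrime F, (hI.le_varIdeal_iff F).2 hF⟩, ?_⟩
    rintro P ⟨hP, hIP⟩ hle
    obtain ⟨G, hG, hGP⟩ := key P hP hIP
    have hFG := (varIdeal_le_varIdeal_iff G F).1 (hGP.trans hle)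
    exact ((varIdeal_le_varIdeal_iff F G).2 (hmax hG hFG)).trans hGP

end IsSquarefreeMonomialIdeal

end SquarefreeIdeals

/-! ### Counting lattice points of given total in upper sets -/

section Counting

variable {ι : Type*}

theorem card_piAntidiag_univ [Fintype ι] [DecidableEq ι] (m : ℕ) :
    (Finset.piAntidiag (Finset.univ : Finset ι) m).card = (Fintype.card ι + m - 1).choose m := by
  rw [← Finset.map_sym_eq_piAntidiag, Finset.card_map, Finset.sym_univ, Finset.card_univ,
    Sym.card_sym_eq_choose]

theorem card_piAntidiag_univ_filter_le [Fintype ι] [DecidableEq ι] (u : ι → ℕ)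
    [DecidablePred (u ≤ ·)] (m : ℕ) :
    ((Finset.piAntidiag (Finset.univ : Finset ι) (m + ∑ i, u i)).filter (u ≤ ·)).card =
      (Finset.piAntidiag (Finset.univ : Finset ι) m).card := by
  symm
  refine Finset.card_bij' (fun v _ => v + u) (fun v _ => v - u) ?_ ?_ ?_ ?_
  · intro v hv
    simp only [Finset.mem_filter, Finset.mem_piAntidiag] at hv ⊢
    refine ⟨⟨?_, fun _ _ => Finset.mem_univ _⟩, le_add_of_nonneg_left zero_le⟩
    simp [Finset.sum_add_distrib, hv.1]
  · intro v hv
    simp only [Finset.mem_filter, Finset.mem_piAntidiag] at hv ⊢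
    refine ⟨?_, fun _ _ => Finset.mem_univ _⟩
    have : ∑ i, (v - u) i + ∑ i, u i = m + ∑ i, u i := by
      rw [← Finset.sum_add_distrib, ← hv.1.1]
      exact Finset.sum_congr rfl fun i _ => Nat.sub_add_cancel (hv.2 i)
    exact Nat.add_right_cancel this
  · intro v _
    exact add_tsub_cancel_right v u
  · intro v hv
    exact tsub_add_cancel_of_le (Finset.mem_filter.1 hv).2

/-- The functions on `ι → ℕ` whose sums over the vectors of total `n` are, for large `n`, given by
a polynomial in `n`. -/
def eventuallyPolynomialSum (ι : Type*) [Fintype ι] [DecidableEq ι] :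
    Submodule ℚ ((ι → ℕ) → ℚ) where
  carrier := {f | ∃ (p : Polynomial ℚ) (n₀ : ℕ), ∀ n ≥ n₀,
    ∑ v ∈ Finset.piAntidiag (Finset.univ : Finset ι) n, f v = p.eval (n : ℚ)}
  zero_mem' := ⟨0, 0, fun n _ => by simp⟩
  add_mem' := by
    rintro f g ⟨p, a, hp⟩ ⟨q, b, hq⟩
    refine ⟨p + q, max a b, fun n hn => ?_⟩
    simp [Finset.sum_add_distrib, hp n (le_of_max_le_left hn), hq n (le_of_max_le_right hn)]
  smul_mem' := by
    rintro r f ⟨p, a, hp⟩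
    refine ⟨Polynomial.C r * p, a, fun n hn => ?_⟩
    simp [← Finset.mul_sum, hp n hn]

theorem indicator_Ici_mem_eventuallyPolynomialSum [Fintype ι] [DecidableEq ι] [Nonempty ι]
    (u : ι → ℕ) :
    (Set.Ici u).indicator 1 ∈ eventuallyPolynomialSum ι := by
  classical
  obtain ⟨r, hr⟩ : ∃ r, Fintype.card ι = r + 1 := ⟨_, (Nat.succ_pred Fintype.card_ne_zero).symm⟩
  -- With `r + 1` coordinates and `m = n - ∑ u i`, translation by `u` leaves `(m + r).choose r`
  -- points, that is, `(m + 1) ⋯ (m + r) / r!`.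
  refine ⟨Polynomial.C ((r.factorial : ℚ)⁻¹) * (ascPochhammer ℚ r).comp
    (Polynomial.X - Polynomial.C ((∑ i, u i : ℕ) : ℚ) + 1), ∑ i, u i, fun n hn => ?_⟩
  obtain ⟨m, rfl⟩ := Nat.exists_eq_add_of_le' hn
  have h1 : ∑ v ∈ Finset.piAntidiag (Finset.univ : Finset ι) (m + ∑ i, u i),
      (Set.Ici u).indicator (1 : (ι → ℕ) → ℚ) v = ((m + r).choose r : ℕ) := by
    simp only [Set.indicator_apply, Set.mem_Ici, Pi.one_apply]
    rw [Finset.sum_boole, card_piAntidiag_univ_filter_le, card_piAntidiag_univ, hr,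
      show r + 1 + m - 1 = m + r by omega, Nat.choose_symm_add]
  rw [h1, Polynomial.eval_mul, Polynomial.eval_C, Polynomial.eval_comp]
  have h2 : ((m + r).choose r : ℚ) = (r.factorial : ℚ)⁻¹ * (ascPochhammer ℚ r).eval (m + 1 : ℚ) := by
    rw [← Nat.cast_one, ← Nat.cast_add, ← ascPochhammer_eval_cast,
      ascPochhammer_nat_eq_ascFactorial, Nat.ascFactorial_eq_factorial_mul_choose]
    push_cast
    rw [inv_mul_cancel_left₀ (by positivity)]
  rw [h2]
  congr 2
  simp [-Nat.cast_sum]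

/-- The algebra of functions on `ι → ℕ` generated by the indicators of the orthants `Set.Ici u`. -/
def orthantAlgebra (ι : Type*) : Subalgebra ℚ ((ι → ℕ) → ℚ) :=
  Algebra.adjoin ℚ (Set.range fun u => (Set.Ici u).indicator (1 : (ι → ℕ) → ℚ))

/-- Orthants are closed under intersection, so their indicators already span the algebra linearly.
-/
theorem orthantAlgebra_le [Fintype ι] [DecidableEq ι] [Nonempty ι] :
    Subalgebra.toSubmodule (orthantAlgebra ι) ≤ eventuallyPolynomialSum ι := by
  classical
  let M : Submonoid ((ι → ℕ) → ℚ) :=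
    { carrier := Set.range fun u => (Set.Ici u).indicator 1
      one_mem' := ⟨0, by ext v; simp⟩
      mul_mem' := by
        rintro _ _ ⟨u, rfl⟩ ⟨w, rfl⟩
        refine ⟨u ⊔ w, ?_⟩
        simp only
        rw [← Set.inter_indicator_one, Set.Ici_inter_Ici] }
  have hM : Submonoid.closure (Set.range fun u : ι → ℕ => (Set.Ici u).indicator (1 : (ι → ℕ) → ℚ))
      = M := Submonoid.closure_eq M
  rw [orthantAlgebra, Algebra.adjoin_eq_span, hM, Submodule.span_le]
  rintro _ ⟨u, rfl⟩
  exact indicator_Ici_mem_eventuallyPolynomialSum u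

/-- By Dickson's lemma `U` is the union of the orthants at its finitely many minimal points; the
product formula is inclusion–exclusion. -/
theorem indicator_mem_orthantAlgebra_of_isUpperSet [Finite ι] {U : Set (ι → ℕ)}
    (hU : IsUpperSet U) :
    U.indicator 1 ∈ orthantAlgebra ι := by
  classical
  have hfin : {u | Minimal (· ∈ U) u}.Finite :=
    WellQuasiOrderedLE.finite_of_isAntichain (setOfPred_minimal_antichain _)
  have : U.indicator (1 : (ι → ℕ) → ℚ) =
      1 - ∏ u ∈ hfin.toFinset, (1 - (Set.Ici u).indicator 1) := by
    ext v
    simp only [Pi.sub_apply, Pi.one_apply, Finset.prod_apply]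
    by_cases hv : v ∈ U
    · obtain ⟨u, huv, hu⟩ := exists_minimal_le_of_wellFoundedLT (· ∈ U) v hv
      rw [Set.indicator_of_mem hv, Finset.prod_eq_zero (hfin.mem_toFinset.2 hu)]
      · simp
      · simp [Set.indicator_of_mem (Set.mem_Ici.2 huv)]
    · rw [Set.indicator_of_notMem hv, Finset.prod_eq_one, sub_self]
      intro u hu
      rw [Set.indicator_of_notMem, sub_zero]
      exact fun huv => hv (hU huv (hfin.mem_toFinset.1 hu).1)
  rw [this]
  refine sub_mem (one_mem _) (prod_mem fun u _ => sub_mem (one_mem _) ?_)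
  exact Algebra.subset_adjoin ⟨u, rfl⟩

/-- The vectors of total `n` outside an upper set `U` and outside the differences `V j \ W j` of
finitely many upper sets are, for large `n`, counted by a polynomial in `n`. -/
theorem exists_polynomial_ncard_of_isUpperSet [Fintype ι] [Nonempty ι] {κ : Type*} [Finite κ]
    {U : Set (ι → ℕ)} {V W : κ → Set (ι → ℕ)} (hU : IsUpperSet U)
    (hV : ∀ j, IsUpperSet (V j)) (hW : ∀ j, IsUpperSet (W j)) :
    ∃ (p : Polynomial ℚ) (n₀ : ℕ), ∀ n ≥ n₀,
      ({v : ι → ℕ | ∑ i, v i = n ∧ v ∉ U ∧ ∀ j, v ∈ V j → v ∈ W j}.ncard : ℚ) =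
        p.eval (n : ℚ) := by
  classical
  have := Fintype.ofFinite κ
  set M : Set (ι → ℕ) := {v | v ∉ U ∧ ∀ j, v ∈ V j → v ∈ W j} with hMdef
  have hM : M.indicator (1 : (ι → ℕ) → ℚ) = (1 - U.indicator 1) *
      ∏ j, (1 - (V j).indicator 1 * (1 - (W j).indicator 1)) := by
    ext v
    simp only [Pi.sub_apply, Pi.one_apply, Finset.prod_apply, Pi.mul_apply]
    by_cases hv : v ∈ M
    · rw [Set.indicator_of_mem hv, Set.indicator_of_notMem hv.1, Finset.prod_eq_one]
      · simp
      · intro j _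
        by_cases hj : v ∈ V j
        · simp [hv.2 j hj]
        · simp [hj]
    · rw [Set.indicator_of_notMem hv]
      symm
      by_cases hvU : v ∈ U
      · simp [hvU]
      · obtain ⟨j, hj, hj'⟩ : ∃ j, v ∈ V j ∧ v ∉ W j := by
          by_contra! h
          exact hv ⟨hvU, h⟩
        rw [Finset.prod_eq_zero (Finset.mem_univ j), mul_zero]
        simp [hj, hj']
  have hmem : M.indicator 1 ∈ orthantAlgebra ι := by
    rw [hM]
    refine mul_mem (sub_mem (one_mem _) (indicator_mem_orthantAlgebra_of_isUpperSet hU))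
      (prod_mem fun j _ => sub_mem (one_mem _) (mul_mem
        (indicator_mem_orthantAlgebra_of_isUpperSet (hV j)) (sub_mem (one_mem _)
          (indicator_mem_orthantAlgebra_of_isUpperSet (hW j)))))
  obtain ⟨p, n₀, hp⟩ := orthantAlgebra_le hmem
  refine ⟨p, n₀, fun n hn => ?_⟩
  rw [← hp n hn]
  simp only [Set.indicator_apply, Pi.one_apply]
  rw [Finset.sum_boole, ← Set.ncard_coe_finset]
  congr 2
  ext v
  simp [hMdef]

end Counting

/-- Two functions with the same fibres on a set have images of the same size. -/
theorem Set.ncard_image_eq_ncard_image {α β γ : Type*} {S : Set α} {f : α → β} {g : α → γ}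
    (h : ∀ a ∈ S, ∀ b ∈ S, f a = f b ↔ g a = g b) : (f '' S).ncard = (g '' S).ncard := by
  refine Set.ncard_congr (fun b hb => g hb.choose) ?_ ?_ ?_
  · intro b hb
    exact ⟨_, hb.choose_spec.1, rfl⟩
  · intro b b' hb hb' hbb
    rw [← hb.choose_spec.2, ← hb'.choose_spec.2]
    exact (h _ hb.choose_spec.1 _ hb'.choose_spec.1).2 hbb
  · rintro _ ⟨a, ha, rfl⟩
    have hb : f a ∈ f '' S := ⟨a, ha, rfl⟩
    exact ⟨f a, hb, (h _ hb.choose_spec.1 _ ha).1 hb.choose_spec.2⟩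

/-! ### Column types as a complete invariant of orbits -/

section Columns

variable {c n m : ℕ}

/-- The `j`-th column of a subset of `[c] × [n]`. -/
def column (F : Finset (Fin c × Fin n)) (j : Fin n) : Finset (Fin c) :=
  Finset.univ.filter fun i => (i, j) ∈ F

@[simp]
theorem mem_column {F : Finset (Fin c × Fin n)} {i : Fin c} {j : Fin n} :
    i ∈ column F j ↔ (i, j) ∈ F := by
  simp [column]

/-- The number of columns of each type in a subset of `[c] × [n]`. -/
def columnCount (F : Finset (Fin c × Fin n)) (A : Finset (Fin c)) : ℕ :=
  (Finset.univ.filter fun j => column F j = A).card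

theorem sum_columnCount (F : Finset (Fin c × Fin n)) : ∑ A, columnCount F A = n := by
  simpa [columnCount] using
    (Finset.card_eq_sum_card_fiberwise (s := Finset.univ) (t := Finset.univ) (f := column F)
      fun _ _ => Finset.mem_coe.2 (Finset.mem_univ _)).symm

theorem columnCount_eq_sum_single (F : Finset (Fin c × Fin n)) :
    columnCount F = ∑ j, Pi.single (column F j) 1 := by
  ext A
  simp only [columnCount, Finset.sum_apply, Pi.single_apply, Finset.card_filter, eq_comm]

/-- Stated additively to avoid truncated subtraction; this is the form used by `exchangeSet`. -/
theorem columnCount_insert_add (F : Finset (Fin c × Fin n)) (i : Fin c) (j : Fin n) :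
    columnCount (insert (i, j) F) + Pi.single (column F j) 1 =
      columnCount F + Pi.single (insert i (column F j)) 1 := by
  have h1 : column (insert (i, j) F) j = insert i (column F j) := by
    ext i'
    simp
  have h2 : ∀ j' ∈ Finset.univ.erase j, column (insert (i, j) F) j' = column F j' := by
    intro j' hj'
    ext i'
    simp [Finset.ne_of_mem_erase hj']
  rw [columnCount_eq_sum_single, columnCount_eq_sum_single,
    ← Finset.add_sum_erase _ _ (Finset.mem_univ j),
    ← Finset.add_sum_erase Finset.univ (fun j => Pi.single (column F j) 1) (Finset.mem_univ j), h1,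
    Finset.sum_congr rfl fun j' hj' => by rw [h2 j' hj']]
  abel

theorem exists_columnCount_eq (v : Finset (Fin c) → ℕ) (hv : ∑ A, v A = n) :
    ∃ F : Finset (Fin c × Fin n), columnCount F = v := by
  have hcard : Fintype.card (Fin n) = Fintype.card (Σ A, Fin (v A)) := by simp [hv]
  let e := Fintype.equivOfCardEq hcard
  refine ⟨Finset.univ.filter fun p => p.1 ∈ (e p.2).1, ?_⟩
  have hcol : ∀ j, column (Finset.univ.filter fun p : Fin c × Fin n => p.1 ∈ (e p.2).1) j =
      (e j).1 := by
    intro j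
    ext i
    simp
  ext A
  simp only [columnCount, hcol]
  rw [← Fintype.card_subtype, Fintype.card_congr ((e.subtypeEquiv fun j => Iff.rfl :
    {j // (e j).1 = A} ≃ {x : Σ A, Fin (v A) // x.1 = A}).trans (Equiv.sigmaSubtype A)),
    Fintype.card_fin]

/-- For each type `A`, the columns of `F` of type `A` embed into those of `G`; the embeddings glue
because the type can be read off the image. -/
theorem exists_injective_of_columnCount_le {F : Finset (Fin c × Fin m)}
    {G : Finset (Fin c × Fin n)} (h : columnCount F ≤ columnCount G) :
    ∃ e : Fin m → Fin n, Function.Injective e ∧ ∀ j, column G (e j) = column F j := by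
  have h1 : ∀ A, Nonempty ({j // column F j = A} ↪ {j // column G j = A}) := by
    intro A
    rw [Function.Embedding.nonempty_iff_card_le]
    rw [Fintype.card_subtype, Fintype.card_subtype]
    exact h A
  let φ := fun A => (h1 A).some
  have hφ : ∀ j, column G (φ _ ⟨j, rfl⟩) = column F j := fun j => (φ _ ⟨j, rfl⟩).2
  refine ⟨fun j => φ _ ⟨j, rfl⟩, fun j j' hj => ?_, hφ⟩
  have hcol : column F j' = column F j := by
    rw [← hφ j, ← hφ j']
    exact congrArg (column G) hj.symm
  have key : ∀ A (hA : column F j' = A), (φ _ ⟨j', rfl⟩ : Fin n) = φ A ⟨j', hA⟩ := by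
    rintro _ rfl
    rfl
  have hj2 : (φ (column F j) ⟨j, rfl⟩ : Fin n) = φ (column F j) ⟨j', hcol⟩ :=
    hj.trans (key _ hcol)
  exact congrArg Subtype.val ((φ _).injective (Subtype.ext hj2))

/-- The permutation of the columns of a subset of `[c] × [n]`. -/
def permColumns (σ : Equiv.Perm (Fin n)) (F : Finset (Fin c × Fin n)) :
    Finset (Fin c × Fin n) :=
  F.map (Equiv.prodCongr (Equiv.refl (Fin c)) σ).toEmbedding

theorem mem_permColumns {σ : Equiv.Perm (Fin n)} {F : Finset (Fin c × Fin n)}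
    {p : Fin c × Fin n} : p ∈ permColumns σ F ↔ (p.1, σ⁻¹ p.2) ∈ F := by
  rw [permColumns, Finset.mem_map_equiv]
  rfl

theorem permColumns_one (F : Finset (Fin c × Fin n)) : permColumns 1 F = F := by
  ext p
  simp [mem_permColumns]

theorem permColumns_permColumns (σ τ : Equiv.Perm (Fin n)) (F : Finset (Fin c × Fin n)) :
    permColumns σ (permColumns τ F) = permColumns (σ * τ) F := by
  ext p
  simp [mem_permColumns]

theorem columnCount_permColumns (σ : Equiv.Perm (Fin n)) (F : Finset (Fin c × Fin n)) :
    columnCount (permColumns σ F) = columnCount F := by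
  rw [columnCount_eq_sum_single, columnCount_eq_sum_single, ← Equiv.sum_comp σ]
  refine Finset.sum_congr rfl fun j _ => ?_
  congr 1
  ext i
  simp [mem_permColumns]

theorem columnCount_eq_iff {F G : Finset (Fin c × Fin n)} :
    columnCount F = columnCount G ↔ ∃ σ, permColumns σ F = G := by
  constructor
  · intro h
    obtain ⟨e, he, heq⟩ := exists_injective_of_columnCount_le h.le
    refine ⟨Equiv.ofBijective e (Finite.injective_iff_bijective.1 he), ?_⟩
    ext ⟨i, j⟩
    obtain ⟨j, rfl⟩ := (Equiv.ofBijective e (Finite.injective_iff_bijective.1 he)).surjective j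
    rw [mem_permColumns, Equiv.Perm.inv_def, Equiv.symm_apply_apply, ← mem_column, ← heq, mem_column]
    rfl
  · rintro ⟨σ, rfl⟩
    exact (columnCount_permColumns σ F).symm

end Columns

/-! ### Orbits of the variable ideals -/

section Orbits

variable {k : Type*} [Field k] {c n : ℕ}

theorem map_symAct_varIdeal (σ : Equiv.Perm (Fin n)) (F : Finset (Fin c × Fin n)) :
    Ideal.map (symAct k c σ) (varIdeal k F) = varIdeal k (permColumns σ F) := by
  rw [varIdeal, Ideal.map_span, varIdeal, Set.image_image]
  congr 1
  ext f
  constructor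
  · rintro ⟨p, hp, rfl⟩
    refine ⟨(p.1, σ p.2), ?_, ?_⟩
    · simpa [mem_permColumns] using hp
    · simp [symAct, Prod.map]
  · rintro ⟨p, hp, rfl⟩
    refine ⟨(p.1, σ⁻¹ p.2), ?_, ?_⟩
    · simpa [mem_permColumns] using hp
    · simp [symAct]

theorem symOrbit_varIdeal (F : Finset (Fin c × Fin n)) :
    symOrbit (varIdeal k F) = Set.range fun σ => varIdeal k (permColumns σ F) := by
  simp only [symOrbit, map_symAct_varIdeal]

theorem symOrbit_varIdeal_eq_iff {F G : Finset (Fin c × Fin n)} :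
    symOrbit (varIdeal k F) = symOrbit (varIdeal k G) ↔ columnCount F = columnCount G := by
  rw [columnCount_eq_iff, symOrbit_varIdeal, symOrbit_varIdeal]
  constructor
  · intro h
    have hG : varIdeal k G ∈ Set.range fun σ => varIdeal k (permColumns σ F) := by
      rw [h]
      exact ⟨1, by simp only [permColumns_one]⟩
    obtain ⟨σ, hσ⟩ := hG
    exact ⟨σ, varIdeal_injective hσ⟩
  · rintro ⟨τ, rfl⟩
    simp only [permColumns_permColumns]
    exact ((Equiv.mulRight τ).surjective.range_comp
      fun σ => varIdeal k (permColumns σ F)).symm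

theorem ncard_symOrbits_varIdeal (S : Set (Finset (Fin c × Fin n))) :
    (symOrbits (varIdeal k '' S)).ncard = (columnCount '' S).ncard := by
  rw [symOrbits, Set.image_image]
  exact Set.ncard_image_eq_ncard_image fun _ _ _ _ => symOrbit_varIdeal_eq_iff

end Orbits

/-! ### Invariant chains in terms of column counts -/

section Chains

variable {k : Type*} [Field k] {c : ℕ}

/-- The vectors that dominate the column counts of a monomial in a chain of ideals. -/
def chainCounts (I : (n : ℕ) → Ideal (SymRing k c n)) : Set (Finset (Fin c) → ℕ) :=
  {v | ∃ m, 1 ≤ m ∧ ∃ F : Finset (Fin c × Fin m), columnCount F ≤ v ∧ sqfreeMonomial k F ∈ I m}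

variable {I : (n : ℕ) → Ideal (SymRing k c n)}

theorem isUpperSet_chainCounts : IsUpperSet (chainCounts I) := by
  rintro v w hvw ⟨m, hm, F, hF, hFI⟩
  exact ⟨m, hm, F, hF.trans hvw, hFI⟩

/-- The type-preserving injection of columns extends to a permutation of `[n]`, which moves `F`
inside `G`. -/
theorem IsSymInvariantChain.sqfreeMonomial_mem (hI : IsSymInvariantChain I) {m n : ℕ}
    (hm : 1 ≤ m) {F : Finset (Fin c × Fin m)} {G : Finset (Fin c × Fin n)}
    (h : columnCount F ≤ columnCount G) (hF : sqfreeMonomial k F ∈ I m) :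
    sqfreeMonomial k G ∈ I n := by
  obtain ⟨e, he, heq⟩ := exists_injective_of_columnCount_le h
  have hmn : m ≤ n := by simpa using Fintype.card_le_of_injective e he
  obtain ⟨σ, hσ⟩ := Equiv.Perm.exists_extending_pair (Fin.castLE hmn) e
    (Fin.castLE_injective hmn) he
  have hmem := hI m n hmn hm _ hF σ
  have hmap : symAct k c σ (symIncl k c hmn (sqfreeMonomial k F)) =
      sqfreeMonomial k (F.image (Prod.map id e)) := by
    rw [sqfreeMonomial, sqfreeMonomial,
      Finset.prod_image ((Function.injective_id.prodMap he).injOn), map_prod, map_prod]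
    refine Finset.prod_congr rfl fun p _ => ?_
    simp [symAct, symIncl, hσ, Prod.map]
  rw [hmap] at hmem
  refine Ideal.mem_of_dvd _ (sqfreeMonomial_dvd ?_) hmem
  intro q hq
  obtain ⟨⟨i, j⟩, hp, rfl⟩ := Finset.mem_image.1 hq
  change (i, e j) ∈ G
  rwa [← mem_column, heq, mem_column]

theorem IsSymInvariantChain.sqfreeMonomial_mem_iff (hI : IsSymInvariantChain I) {n : ℕ}
    (hn : 1 ≤ n) (G : Finset (Fin c × Fin n)) :
    sqfreeMonomial k G ∈ I n ↔ columnCount G ∈ chainCounts I :=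
  ⟨fun h => ⟨n, hn, G, le_rfl, h⟩, fun ⟨_, hm, _, hle, hF⟩ => hI.sqfreeMonomial_mem hm hle hF⟩

/-- The vectors for which the replacement of one letter `A` by `B` leads into `U`. -/
def exchangeSet {ι : Type*} [DecidableEq ι] (U : Set (ι → ℕ)) (A B : ι) : Set (ι → ℕ) :=
  {v | ∃ w ∈ U, w + Pi.single A 1 = v + Pi.single B 1}

theorem IsUpperSet.exchangeSet {ι : Type*} [DecidableEq ι] {U : Set (ι → ℕ)} (hU : IsUpperSet U)
    (A B : ι) : IsUpperSet (exchangeSet U A B) := by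
  rintro v v' hle ⟨w, hw, hwv⟩
  refine ⟨w + (v' - v), hU (le_add_of_nonneg_right zero_le) hw, ?_⟩
  rw [add_right_comm, hwv, add_right_comm, add_tsub_cancel_of_le hle]

theorem IsSymInvariantChain.maximal_iff (hI : IsSymInvariantChain I) {n : ℕ}
    (hn : 1 ≤ n) (F : Finset (Fin c × Fin n)) :
    Maximal (fun F => sqfreeMonomial k F ∉ I n) F ↔ columnCount F ∉ chainCounts I ∧
      ∀ p : {p : Finset (Fin c) × Fin c // p.2 ∉ p.1}, 1 ≤ columnCount F p.1.1 →
        columnCount F ∈ exchangeSet (chainCounts I) p.1.1 (insert p.1.2 p.1.1) := by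
  -- Nonmembership passes to subsets, so adding a single variable suffices as a test.
  rw [Finset.maximal_iff_forall_insert
    fun s t ht hst hs => ht (Ideal.mem_of_dvd _ (sqfreeMonomial_dvd hst) hs)]
  simp only [not_not, hI.sqfreeMonomial_mem_iff hn]
  refine and_congr_right fun _ => ⟨?_, ?_⟩
  · rintro h ⟨⟨A, i⟩, hi⟩ hA
    obtain ⟨j, hj⟩ := Finset.card_pos.1 hA
    obtain rfl : column F j = A := (Finset.mem_filter.1 hj).2
    exact ⟨_, h (i, j) (fun hij => hi (mem_column.2 hij)), columnCount_insert_add F i j⟩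
  · rintro h ⟨i, j⟩ hij
    obtain ⟨w, hw, hwF⟩ := h ⟨(column F j, i), fun hi => hij (mem_column.1 hi)⟩
      (Finset.card_pos.2 ⟨j, by simp⟩)
    rw [← columnCount_insert_add F i j] at hwF
    rwa [← add_right_cancel hwF]

theorem IsSymInvariantChain.image_columnCount_maximal (hI : IsSymInvariantChain I) {n : ℕ}
    (hn : 1 ≤ n) :
    columnCount '' {F | Maximal (fun F => sqfreeMonomial k F ∉ I n) F} =
      {v : Finset (Fin c) → ℕ | ∑ A, v A = n ∧ v ∉ chainCounts I ∧
        ∀ p : {p : Finset (Fin c) × Fin c // p.2 ∉ p.1}, v ∈ {v | 1 ≤ v p.1.1} →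
          v ∈ exchangeSet (chainCounts I) p.1.1 (insert p.1.2 p.1.1)} := by
  ext v
  constructor
  · rintro ⟨F, hF, rfl⟩
    exact ⟨sum_columnCount F, (hI.maximal_iff hn F).1 hF⟩
  · rintro ⟨hv, hv'⟩
    obtain ⟨F, rfl⟩ := exists_columnCount_eq v hv
    exact ⟨F, (hI.maximal_iff hn F).2 hv', rfl⟩

end Chains

theorem mainTheorem3 {k : Type*} [Field k] (c : ℕ) (hc : 1 ≤ c)
    (I : (n : ℕ) → Ideal (SymRing k c n))
    (hsf : ∀ n : ℕ, 1 ≤ n → IsSquarefreeMonomialIdeal (I n))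
    (hI : IsSymInvariantChain I) :
    ∃ (p : Polynomial ℚ) (n₀ : ℕ), ∀ n : ℕ, n₀ ≤ n →
      ((symOrbits (primaryComponents (I n))).Finite ∧
        ((symOrbits (primaryComponents (I n))).ncard : ℚ) = p.eval (n : ℚ)) ∧
      ((symOrbits (associatedPrimes (SymRing k c n) (SymRing k c n ⧸ I n))).Finite ∧
        ((symOrbits (associatedPrimes (SymRing k c n) (SymRing k c n ⧸ I n))).ncard : ℚ)
          = p.eval (n : ℚ)) := by
  have hcount := exists_polynomial_ncard_of_isUpperSet (isUpperSet_chainCounts (I := I))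
    (V := fun p : {p : Finset (Fin c) × Fin c // p.2 ∉ p.1} => {v | 1 ≤ v p.1.1})
    (W := fun p => exchangeSet (chainCounts I) p.1.1 (insert p.1.2 p.1.1))
    (fun p v w hvw hv => le_trans (show 1 ≤ v p.1.1 from hv) (hvw p.1.1))
    (fun p => isUpperSet_chainCounts.exchangeSet _ _)
  obtain ⟨p, n₀, hp⟩ := hcount
  -- The hypotheses say nothing about `I 0`.
  refine ⟨p, max 1 n₀, fun n hn => ?_⟩
  have hn1 : 1 ≤ n := le_of_max_le_left hn
  have hrad := (hsf n hn1).isRadical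
  rw [hrad.primaryComponents_eq_minimalPrimes, hrad.associatedPrimes_eq_minimalPrimes, and_self,
    (hsf n hn1).minimalPrimes_eq]
  refine ⟨((Set.toFinite _).image _).image _, ?_⟩
  rw [ncard_symOrbits_varIdeal, hI.image_columnCount_maximal hn1]
  exact hp n (le_of_max_le_right hn)
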